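/- Let $P_n$ be the path on $n\ge 1$ vertices and let $u$ be a vertex of $P_n$. For $m\ge 1$, the $m$-fold blow-up $\overset{m}{\uplus}P_n$ is the graph with vertex set $\mathbb Z_m\times V(P_n)$ in which $(k,v)$ and $(l,w)$ are adjacent if and only if $v$ and $w$ are adjacent in $P_n$. For a finite simple graph with adjacency matrix $A$ put $U(t)=\exp(itA)$, $t\in\mathbb R$. A vertex $x$ is periodic at time $\tau>0$ if $|U(\tau)_{x,x}|=1$, and periodic if this holds for some $\tau>0$; its minimum period is the least such $\tau$. There is perfect state transfer (PST) between vertices $x$ and $y$ at time $\tau>0$ if $|U(\tau)_{x,y}|=1$. Let $S_u=\{(j,u):j\in\mathbb Z_m\}$. 1. Let $n\ge 2$. For every $m\ge 1$, each vertex in $S_u$ is periodic in $\overset{m}{\uplus}P_n$ if and only if (i) $u$ is any vertex of $P_2$ (that is, $n=2$), (ii) $u$ is any vertex of $P_3$ ($n=3$), or (iii) $u$ is the middle vertex of $P_5$. In these cases, every vertex in $S_u$ is periodic at time $\tau=\frac{2\pi}{m}$, $\tau=\frac{2\pi}{\sqrt2\,m}$, $\tau=\frac{2\pi}{\sqrt3\,m}$,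 respectively. This $\tau$ is the minimum period, except when $m=1$ and $u$ is a vertex of $P_2$ or the middle vertex of $P_3$; in these exceptional cases the minimum period is $\tau/2$, that is, $\pi$ and $\frac{\pi}{\sqrt2}$, respectively. 2. The graph $\overset{2}{\uplus}P_n$ admits PST between $(0,u)$ and $(1,u)$ if and only if (i) $u$ is any vertex of $P_2$, or (ii) $u$ is the middle vertex of $P_3$. The minimum PST time is $\frac{\pi}{2}$ in case (i) and $\frac{\pi}{2\sqrt2}$ in case (ii). -/

import Mathlib

/-- The `m`-fold blow-up of `G`: the graph on `ZMod m × V` in which `(k, u)` and `(l, v)` are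
adjacent if and only if `u` and `v` are adjacent in `G`. -/
def blowUp (m : ℕ) {V : Type*} (G : SimpleGraph V) : SimpleGraph (ZMod m × V) where
  Adj x y := G.Adj x.2 y.2
  symm := ⟨fun _ _ h => SimpleGraph.Adj.symm h⟩
  loopless := ⟨fun x h => SimpleGraph.Adj.ne h rfl⟩

open Classical in
/-- The transition matrix `U(t) = exp(i t A)` of the continuous-time quantum walk on `G`, where `A`
is the adjacency matrix of `G`. -/
noncomputable def transitionMatrix {V : Type*} [Fintype V] (G : SimpleGraph V) (t : ℝ) :
    Matrix V V ℂ :=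
  NormedSpace.exp ((Complex.I * (t : ℂ)) • G.adjMatrix ℂ)

/-- Perfect state transfer between `u` and `v` in `G` at time `t > 0`. -/
def HasPSTAt {V : Type*} [Fintype V] (G : SimpleGraph V) (u v : V) (t : ℝ) : Prop :=
  0 < t ∧ ‖transitionMatrix G t u v‖ = 1

/-- `G` admits perfect state transfer between `u` and `v`. -/
def HasPST {V : Type*} [Fintype V] (G : SimpleGraph V) (u v : V) : Prop :=
  ∃ t : ℝ, HasPSTAt G u v t

/-- `t` is the minimum time of perfect state transfer between `u` and `v` in `G`. -/
def IsMinPSTTime {V : Type*} [Fintype V] (G : SimpleGraph V) (u v : V) (t : ℝ) : Prop :=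
  IsLeast {s : ℝ | HasPSTAt G u v s} t

/-- `u` is periodic in `G` at time `t > 0`. -/
def IsPeriodicAt {V : Type*} [Fintype V] (G : SimpleGraph V) (u : V) (t : ℝ) : Prop :=
  0 < t ∧ ‖transitionMatrix G t u u‖ = 1

/-- `u` is periodic in `G`. -/
def IsPeriodicVertex {V : Type*} [Fintype V] (G : SimpleGraph V) (u : V) : Prop :=
  ∃ t : ℝ, IsPeriodicAt G u t

/-- `t` is the least positive time at which `u` is periodic in `G`. -/
def IsMinPeriod {V : Type*} [Fintype V] (G : SimpleGraph V) (u : V) (t : ℝ) : Prop :=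
  IsLeast {s : ℝ | IsPeriodicAt G u s} t

/-! The blow-up has adjacency matrix J ⊗ A, with J the all-ones matrix of size m and A the adjacency
matrix of the path. An eigenvector v of A with eigenvalue μ gives 1 ⊗ v with eigenvalue mμ, and g ⊗
v lies in the kernel when g sums to zero. By unitarity, an entry U(t)_{x,y} of modulus 1 is the only
nonzero entry of its row, so every eigenvector w satisfies U(t)_{x,y} w_y = exp(itμ) w_x
(`transitionMatrix_mul_eigenvector`). Eigenvectors not vanishing at u thus constrain t; two of them
give a relation free of the unknown phase. Necessity: the eigenvalues 2cos(kπ/(n+1)) in the support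
of u must be commensurable. Multiple-angle formulas then make 4cos²(π/(n+1)) rational, and Niven's
theorem leaves n = 2, 3, 5 (`eq_of_commensurable`). For transfer, every eigenvalue in the support of
u has phase -1, so 0 is excluded from the support. Sufficiency: in the surviving cases A³e_u =
λ²Ae_u, so the support lies in {0, λ, -λ} and U(t)e_u is explicit whenever exp(itmλ) = ±1
(`transitionMatrix_blowUp_apply`). -/

open scoped Matrix

/-! ### The walk on eigenvectors, and unitarity -/

section Walk

variable {V : Type*} [Fintype V]

open Classical in
/-- The adjacency operator of `G` acting on complex functions on the vertices. -/
noncomputable def adjOp (G : SimpleGraph V) (w : V → ℂ) : V → ℂ :=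
  G.adjMatrix ℂ *ᵥ w

theorem adjOp_apply (G : SimpleGraph V) [DecidableRel G.Adj] (w : V → ℂ) (x : V) :
    adjOp G w x = ∑ y, if G.Adj x y then w y else 0 := by
  unfold adjOp Matrix.mulVec dotProduct
  refine Finset.sum_congr rfl fun y _ => ?_
  by_cases h : G.Adj x y <;> simp [SimpleGraph.adjMatrix_apply, h]

theorem adjOp_smul (G : SimpleGraph V) (c : ℂ) (w : V → ℂ) :
    adjOp G (c • w) = c • adjOp G w :=
  Matrix.mulVec_smul _ _ _

theorem adjOp_add (G : SimpleGraph V) (v w : V → ℂ) :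
    adjOp G (v + w) = adjOp G v + adjOp G w :=
  Matrix.mulVec_add _ _ _

theorem adjOp_sub (G : SimpleGraph V) (v w : V → ℂ) :
    adjOp G (v - w) = adjOp G v - adjOp G w :=
  Matrix.mulVec_sub _ _ _

theorem Matrix.exp_mulVec_of_mulVec_eq_smul [DecidableEq V] {M : Matrix V V ℂ} {w : V → ℂ}
    {μ : ℂ} (h : M *ᵥ w = μ • w) : NormedSpace.exp M *ᵥ w = Complex.exp μ • w := by
  let _ : NormedRing (Matrix V V ℂ) := Matrix.linftyOpNormedRing
  let _ : NormedAlgebra ℂ (Matrix V V ℂ) := Matrix.linftyOpNormedAlgebra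
  have hpow : ∀ k : ℕ, M ^ k *ᵥ w = μ ^ k • w := by
    intro k
    induction k with
    | zero => simp
    | succ k ih =>
      rw [pow_succ, ← Matrix.mulVec_mulVec, h, Matrix.mulVec_smul, ih, smul_smul, pow_succ,
        mul_comm]
  have h1 := NormedSpace.exp_series_hasSum_exp' (𝕂 := ℂ) M
  have h2 : HasSum (fun k : ℕ => ((k.factorial : ℂ)⁻¹ • M ^ k) *ᵥ w)
      (NormedSpace.exp M *ᵥ w) :=
    h1.map (Matrix.mulVecBilin ℂ ℂ |>.flip w).toAddMonoidHom (by
      change Continuous fun N : Matrix V V ℂ => N *ᵥ w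
      fun_prop)
  have h3 := NormedSpace.exp_series_hasSum_exp' (𝕂 := ℂ) μ
  rw [← Complex.exp_eq_exp_ℂ] at h3
  have h4 := h3.smul_const w
  refine h2.unique (h4.congr_fun ?_)
  intro k
  simp [Matrix.smul_mulVec, hpow, smul_smul]

theorem transitionMatrix_mulVec_of_adjOp_eq_smul {G : SimpleGraph V} {w : V → ℂ} {μ : ℂ}
    (h : adjOp G w = μ • w) (t : ℝ) :
    transitionMatrix G t *ᵥ w = Complex.exp (Complex.I * t * μ) • w := by
  classical
  unfold transitionMatrix
  convert Matrix.exp_mulVec_of_mulVec_eq_smul (μ := Complex.I * t * μ) _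
  rw [Matrix.smul_mulVec, mul_smul (Complex.I * (t : ℂ)), ← h]
  rfl

theorem transitionMatrix_mulVec_of_adjOp_cubed {G : SimpleGraph V} {w : V → ℂ} {μ : ℂ}
    (hμ : μ ≠ 0) (h : adjOp G (adjOp G (adjOp G w)) = μ ^ 2 • adjOp G w) {t : ℝ} {c : ℂ}
    (hc : Complex.exp (Complex.I * t * μ) = c) (hc2 : c ^ 2 = 1) :
    transitionMatrix G t *ᵥ w = w + ((c - 1) / μ ^ 2) • adjOp G (adjOp G w) := by
  set a := adjOp G w with ha
  set b := adjOp G a with hb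
  have h0 : adjOp G (μ ^ 2 • w - b) = (0 : ℂ) • (μ ^ 2 • w - b) := by
    rw [adjOp_sub, adjOp_smul, ← ha, h]; simp
  have h1 : adjOp G (b + μ • a) = μ • (b + μ • a) := by
    rw [adjOp_add, adjOp_smul, ← hb, h]; module
  have h2 : adjOp G (b - μ • a) = (-μ) • (b - μ • a) := by
    rw [adjOp_sub, adjOp_smul, ← hb, h]; module
  have hcn : Complex.exp (Complex.I * t * (-μ)) = c := by
    rw [mul_neg, Complex.exp_neg, hc]
    exact inv_eq_of_mul_eq_one_left (by rw [← sq, hc2])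
  have h0' := transitionMatrix_mulVec_of_adjOp_eq_smul h0 t
  have h1' := transitionMatrix_mulVec_of_adjOp_eq_smul h1 t
  have h2' := transitionMatrix_mulVec_of_adjOp_eq_smul h2 t
  rw [hc] at h1'
  rw [hcn] at h2'
  rw [mul_zero, Complex.exp_zero, one_smul] at h0'
  -- Components of `w` for the eigenvalues 0, μ and -μ. Since c = ±1, the last two acquire the same
  -- factor `c`.
  have hw : w = (1 / μ ^ 2) • (μ ^ 2 • w - b) + (1 / (2 * μ ^ 2)) • (b + μ • a)
      + (1 / (2 * μ ^ 2)) • (b - μ • a) := by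
    ext x
    simp only [Pi.add_apply, Pi.smul_apply, Pi.sub_apply, smul_eq_mul]
    field_simp
    ring
  conv_lhs => rw [hw]
  rw [Matrix.mulVec_add, Matrix.mulVec_add, Matrix.mulVec_smul, Matrix.mulVec_smul,
    Matrix.mulVec_smul, h0', h1', h2']
  ext x
  simp only [Pi.add_apply, Pi.smul_apply, Pi.sub_apply, smul_eq_mul]
  field_simp
  ring

theorem transitionMatrix_mul_conjTranspose [DecidableEq V] (G : SimpleGraph V) (t : ℝ) :
    transitionMatrix G t * (transitionMatrix G t)ᴴ = 1 := by
  classical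
  unfold transitionMatrix
  have hs : ((Complex.I * (t : ℂ)) • G.adjMatrix ℂ)ᴴ =
      -((Complex.I * (t : ℂ)) • G.adjMatrix ℂ) := by
    rw [Matrix.conjTranspose_smul]
    ext x y
    by_cases hxy : G.Adj x y <;>
      simp [SimpleGraph.adjMatrix_apply, hxy, G.adj_comm y x]
  have key : NormedSpace.exp ((Complex.I * (t : ℂ)) • G.adjMatrix ℂ) *
      (NormedSpace.exp ((Complex.I * (t : ℂ)) • G.adjMatrix ℂ))ᴴ = 1 := by
    rw [← Matrix.exp_conjTranspose, hs,
      ← Matrix.exp_add_of_commute _ _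
        (Commute.neg_right (Commute.refl ((Complex.I * (t : ℂ)) • G.adjMatrix ℂ))),
      add_neg_cancel, NormedSpace.exp_zero]
  convert key

/-- Each row of a unitary matrix has norm 1, so an entry of modulus 1 exhausts its row. -/
theorem transitionMatrix_apply_eq_zero {G : SimpleGraph V} {t : ℝ} {x y z : V}
    (h : ‖transitionMatrix G t x y‖ = 1) (hz : z ≠ y) : transitionMatrix G t x z = 0 := by
  classical
  have h1 := congrFun (congrFun (transitionMatrix_mul_conjTranspose G t) x) x
  rw [Matrix.mul_apply, Matrix.one_apply_eq] at h1
  have h2 : ∑ y, ‖transitionMatrix G t x y‖ ^ 2 = 1 := by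
    have : ((∑ y, ‖transitionMatrix G t x y‖ ^ 2 : ℝ) : ℂ) = 1 := by
      rw [← h1]
      push_cast
      refine Finset.sum_congr rfl fun y _ => ?_
      rw [Matrix.conjTranspose_apply]
      exact (Complex.mul_conj' _).symm
    exact_mod_cast this
  rw [← Finset.add_sum_erase _ _ (Finset.mem_univ y), h] at h2
  have h3 : ∑ a ∈ Finset.univ.erase y, ‖transitionMatrix G t x a‖ ^ 2 = 0 := by linarith
  have h4 := (Finset.sum_eq_zero_iff_of_nonneg (fun a _ => sq_nonneg _)).1 h3 z
    (Finset.mem_erase.2 ⟨hz, Finset.mem_univ _⟩)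
  simpa using h4

theorem transitionMatrix_mul_eigenvector {G : SimpleGraph V} {t : ℝ} {x y : V}
    (h : ‖transitionMatrix G t x y‖ = 1) {w : V → ℂ} {μ : ℂ} (hw : adjOp G w = μ • w) :
    transitionMatrix G t x y * w y = Complex.exp (Complex.I * t * μ) * w x := by
  have h1 := congrFun (transitionMatrix_mulVec_of_adjOp_eq_smul hw t) x
  rw [Pi.smul_apply, smul_eq_mul, Matrix.mulVec, dotProduct,
    Finset.sum_eq_single y (fun z _ hz => by rw [transitionMatrix_apply_eq_zero h hz, zero_mul])
      (by simp)] at h1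
  exact h1

end Walk

/-! ### Phases equal to one -/

theorem Complex.exists_int_of_exp_eq_one {a : ℝ} (h : Complex.exp (Complex.I * a) = 1) :
    ∃ k : ℤ, a = k * (2 * Real.pi) := by
  obtain ⟨k, hk⟩ := Complex.exp_eq_one_iff.1 h
  refine ⟨k, ?_⟩
  have : Complex.I * (a : ℂ) = Complex.I * ((k * (2 * Real.pi) : ℝ) : ℂ) := by
    rw [hk]; push_cast; ring
  exact_mod_cast mul_left_cancel₀ Complex.I_ne_zero this

theorem two_pi_le_of_exp_eq_one {a : ℝ} (ha : 0 < a) (h : Complex.exp (Complex.I * a) = 1) :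
    2 * Real.pi ≤ a := by
  obtain ⟨k, hk⟩ := Complex.exists_int_of_exp_eq_one h
  have hπ := Real.pi_pos
  have hk0 : 0 < k := by
    have : (0 : ℝ) < k := by
      by_contra hn
      push Not at hn
      nlinarith
    exact_mod_cast this
  have : (1 : ℝ) ≤ k := by exact_mod_cast hk0
  nlinarith

/-! ### Spectrum, periodicity and state transfer in blow-ups -/

section BlowUp

variable {V : Type*} [Fintype V] {m : ℕ} [NeZero m]

/-- The adjacency matrix is J ⊗ A, and J sends `g` to the constant function with value its sum. -/
theorem adjOp_blowUp (G : SimpleGraph V) (g : ZMod m → ℂ) (v : V → ℂ) :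
    adjOp (blowUp m G) (fun p => g p.1 * v p.2) = fun p => (∑ k, g k) * adjOp G v p.2 := by
  classical
  ext p
  rw [adjOp_apply, adjOp_apply, Fintype.sum_prod_type, Finset.sum_mul_sum]
  refine Finset.sum_congr rfl fun k _ => Finset.sum_congr rfl fun y _ => ?_
  change (if G.Adj p.2 y then g k * v y else 0) = _
  split_ifs <;> simp

theorem adjOp_blowUp_const {G : SimpleGraph V} {v : V → ℂ} {μ : ℂ} (hv : adjOp G v = μ • v) :
    adjOp (blowUp m G) (fun p => v p.2) = ((m : ℂ) * μ) • (fun p => v p.2) := by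
  have := adjOp_blowUp (m := m) G (fun _ => 1) v
  simp only [one_mul] at this
  rw [this, hv]
  ext p
  simp [mul_assoc]

theorem adjOp_blowUp_eq_zero (G : SimpleGraph V) (g : ZMod m → ℂ) (v : V → ℂ)
    (hg : ∑ k, g k = 0) :
    adjOp (blowUp m G) (fun p => g p.1 * v p.2) = (0 : ℂ) • (fun p => g p.1 * v p.2) := by
  rw [adjOp_blowUp, hg]
  ext p
  simp

open Classical in
theorem transitionMatrix_blowUp_apply {G : SimpleGraph V} {u : V} {lam : ℝ} (hl : 0 < lam)
    (hcube : adjOp G (adjOp G (adjOp G (Pi.single u 1))) =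
      (lam ^ 2 : ℂ) • adjOp G (Pi.single u 1)) {t : ℝ} {c : ℂ}
    (hc : Complex.exp (Complex.I * ((t * (m * lam) : ℝ) : ℂ)) = c) (hc2 : c ^ 2 = 1)
    (j k : ZMod m) :
    transitionMatrix (blowUp m G) t (k, u) (j, u) =
      (if k = j then 1 else 0) +
        (c - 1) / (m * lam ^ 2) * adjOp G (adjOp G (Pi.single u 1)) u := by
  have hm : (m : ℂ) ≠ 0 := Nat.cast_ne_zero.2 (NeZero.ne m)
  have hl' : (lam : ℂ) ≠ 0 := Complex.ofReal_ne_zero.2 hl.ne'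
  set e : V → ℂ := Pi.single u 1
  have hs : (Pi.single (j, u) 1 : ZMod m × V → ℂ) =
      fun p => (Pi.single j 1 : ZMod m → ℂ) p.1 * e p.2 := by
    ext ⟨a, b⟩
    by_cases h1 : a = j <;> by_cases h2 : b = u <;> simp [e, h1, h2]
  have h1 : adjOp (blowUp m G) (Pi.single (j, u) 1) = fun p => (1 : ℂ) * adjOp G e p.2 := by
    rw [hs, adjOp_blowUp]; simp
  have h2 : adjOp (blowUp m G) (adjOp (blowUp m G) (Pi.single (j, u) 1)) =
      fun p => (m : ℂ) * adjOp G (adjOp G e) p.2 := by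
    rw [h1, adjOp_blowUp (m := m) G (fun _ => 1)]; simp
  -- The first application turns e_j into the constant 1, and each later one contributes a factor m.
  -- So the cubic relation persists with mλ in place of λ.
  have h3 : adjOp (blowUp m G) (adjOp (blowUp m G) (adjOp (blowUp m G) (Pi.single (j, u) 1))) =
      ((m : ℂ) * lam) ^ 2 • adjOp (blowUp m G) (Pi.single (j, u) 1) := by
    rw [h2, adjOp_blowUp (m := m) G (fun _ => (m : ℂ)), hcube, h1]
    ext p
    simp
    ring
  have h4 := congrFun (transitionMatrix_mulVec_of_adjOp_cubed (mul_ne_zero hm hl') h3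
    (t := t) (c := c) (by rw [← hc]; push_cast; ring_nf) hc2) (k, u)
  rw [Matrix.mulVec_single_one, h2] at h4
  simp only [Matrix.col_apply, Pi.add_apply, Pi.smul_apply, smul_eq_mul] at h4
  rw [h4]
  congr 1
  · by_cases h : k = j <;> simp [h]
  · field_simp

/-- With a second copy available, (e_j - e_k) ⊗ 1 is a kernel vector that is nonzero at (j, u), and
eigenvalue 0 has phase 1. -/
theorem transitionMatrix_blowUp_eq_one (hm : m ≠ 1) {G : SimpleGraph V} {j : ZMod m} {u : V}
    {t : ℝ} (h : ‖transitionMatrix (blowUp m G) t (j, u) (j, u)‖ = 1) :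
    transitionMatrix (blowUp m G) t (j, u) (j, u) = 1 := by
  have : Nontrivial (ZMod m) := ZMod.nontrivial_iff.2 hm
  obtain ⟨k, hk⟩ := exists_ne j
  have := transitionMatrix_mul_eigenvector h (adjOp_blowUp_eq_zero G
    (Pi.single j 1 - Pi.single k 1) (fun _ => 1) (by simp))
  simpa [Pi.single_apply, hk.symm] using this

theorem isPeriodicAt_blowUp {G : SimpleGraph V} {u : V} {lam : ℝ} (hl : 0 < lam)
    [DecidableEq V]
    (hcube : adjOp G (adjOp G (adjOp G (Pi.single u 1))) =
      (lam ^ 2 : ℂ) • adjOp G (Pi.single u 1)) (j : ZMod m) :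
    IsPeriodicAt (blowUp m G) (j, u) (2 * Real.pi / (lam * m)) := by
  have hm : (0 : ℝ) < m := Nat.cast_pos.2 (NeZero.pos m)
  have hπ := Real.pi_pos
  refine ⟨by positivity, ?_⟩
  have hc : Complex.exp (Complex.I * ((2 * Real.pi / (lam * m) * (m * lam) : ℝ) : ℂ)) = 1 := by
    have : 2 * Real.pi / (lam * m) * (m * lam) = 2 * Real.pi := by field_simp
    rw [this]
    push_cast
    rw [mul_comm, Complex.exp_two_pi_mul_I]
  rw [transitionMatrix_blowUp_apply hl (by convert hcube) hc (by simp)]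
  simp

theorem isMinPeriod_blowUp {G : SimpleGraph V} {u : V} {lam : ℝ} (hl : 0 < lam)
    [DecidableEq V]
    (hcube : adjOp G (adjOp G (adjOp G (Pi.single u 1))) =
      (lam ^ 2 : ℂ) • adjOp G (Pi.single u 1))
    {v : V → ℂ} (hv : adjOp G v = (lam : ℂ) • v) (hvu : v u ≠ 0)
    (h0 : m ≠ 1 ∨ ∃ v₀ : V → ℂ, adjOp G v₀ = (0 : ℂ) • v₀ ∧ v₀ u ≠ 0) (j : ZMod m) :
    IsMinPeriod (blowUp m G) (j, u) (2 * Real.pi / (lam * m)) := by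
  have hm : (0 : ℝ) < m := Nat.cast_pos.2 (NeZero.pos m)
  refine ⟨isPeriodicAt_blowUp hl hcube j, ?_⟩
  rintro s ⟨hs, hp⟩
  -- A kernel vector not vanishing at the vertex fixes the phase: it comes from the blow-up if m ≠
  -- 1, and from `G` otherwise.
  have hone : transitionMatrix (blowUp m G) s (j, u) (j, u) = 1 := by
    rcases h0 with h0 | ⟨v₀, hv₀, hu₀⟩
    · exact transitionMatrix_blowUp_eq_one h0 hp
    · have := transitionMatrix_mul_eigenvector hp (adjOp_blowUp_const (m := m) hv₀)
      simpa [hu₀] using this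
  have h1 := transitionMatrix_mul_eigenvector hp (adjOp_blowUp_const (m := m) hv)
  rw [hone] at h1
  have h2 := mul_right_cancel₀ hvu h1
  have h3 := two_pi_le_of_exp_eq_one (a := s * (lam * m)) (by positivity)
    (by rw [h2]; push_cast; ring_nf)
  rwa [div_le_iff₀ (by positivity)]

/-- The hypothesis `hsq` says that e_u has no component in the kernel. The support is then {λ, -λ},
so the common phase -1 is allowed and the period halves. -/
theorem isMinPeriod_blowUp_one {G : SimpleGraph V} {u : V} {lam : ℝ} (hl : 0 < lam)
    [DecidableEq V]
    (hcube : adjOp G (adjOp G (adjOp G (Pi.single u 1))) =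
      (lam ^ 2 : ℂ) • adjOp G (Pi.single u 1))
    (hsq : adjOp G (adjOp G (Pi.single u 1)) u = (lam ^ 2 : ℂ))
    {v v' : V → ℂ} (hv : adjOp G v = (lam : ℂ) • v) (hvu : v u ≠ 0)
    (hv' : adjOp G v' = (-lam : ℂ) • v') (hvu' : v' u ≠ 0) (j : ZMod 1) :
    IsMinPeriod (blowUp 1 G) (j, u) (Real.pi / lam) := by
  have hπ := Real.pi_pos
  have hl' : (lam : ℂ) ≠ 0 := Complex.ofReal_ne_zero.2 hl.ne'
  refine ⟨⟨by positivity, ?_⟩, ?_⟩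
  · have hc : Complex.exp
        (Complex.I * ((Real.pi / lam * ((1 : ℕ) * lam) : ℝ) : ℂ)) = -1 := by
      have : Real.pi / lam * ((1 : ℕ) * lam) = Real.pi := by field_simp; simp
      rw [this, mul_comm, Complex.exp_pi_mul_I]
    rw [transitionMatrix_blowUp_apply hl (by convert hcube) hc (by simp)]
    convert_to ‖(1 : ℂ) + (-1 - 1) / ((1 : ℕ) * (lam : ℂ) ^ 2) * (lam : ℂ) ^ 2‖ = 1
    · rw [if_pos rfl, ← hsq]
      congr!
    · rw [Nat.cast_one, one_mul, div_mul_cancel₀ _ (pow_ne_zero 2 hl')]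
      norm_num
  · rintro s ⟨hs, hp⟩
    have h1 := transitionMatrix_mul_eigenvector hp (adjOp_blowUp_const (m := 1) hv)
    have h2 := transitionMatrix_mul_eigenvector hp (adjOp_blowUp_const (m := 1) hv')
    have h3 := (mul_right_cancel₀ hvu h1).symm.trans (mul_right_cancel₀ hvu' h2)
    -- Dividing the phases at λ and -λ cancels the unknown diagonal entry.
    have h4 := two_pi_le_of_exp_eq_one (a := 2 * (s * lam)) (by positivity) (by
      have : Complex.I * ((2 * (s * lam) : ℝ) : ℂ) =
          Complex.I * s * ((1 : ℕ) * lam) - Complex.I * s * ((1 : ℕ) * -lam) := by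
        push_cast; ring
      rw [this, Complex.exp_sub, h3, div_self (Complex.exp_ne_zero _)])
    rw [div_le_iff₀ hl]
    linarith

/-- The kernel vector (e_0 - e_1) ⊗ 1 takes opposite values at the two copies. -/
theorem transitionMatrix_blowUp_two_eq_neg_one {G : SimpleGraph V} {u : V} {t : ℝ}
    (h : ‖transitionMatrix (blowUp 2 G) t (0, u) (1, u)‖ = 1) :
    transitionMatrix (blowUp 2 G) t (0, u) (1, u) = -1 := by
  have := transitionMatrix_mul_eigenvector h (adjOp_blowUp_eq_zero G
    (Pi.single 0 1 - Pi.single 1 1) (fun _ => 1) (by simp))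
  have h2 : -transitionMatrix (blowUp 2 G) t (0, u) (1, u) = 1 := by
    simpa [Pi.single_apply] using this
  rw [← h2, neg_neg]

theorem exp_eq_neg_one_of_hasPSTAt {G : SimpleGraph V} {u : V} {t : ℝ}
    (h : HasPSTAt (blowUp 2 G) (0, u) (1, u) t) {v : V → ℂ} {lam : ℝ}
    (hv : adjOp G v = (lam : ℂ) • v) (hvu : v u ≠ 0) :
    Complex.exp (Complex.I * ((t * 2 * lam : ℝ) : ℂ)) = -1 := by
  have h1 := transitionMatrix_mul_eigenvector h.2 (adjOp_blowUp_const (m := 2) hv)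
  rw [transitionMatrix_blowUp_two_eq_neg_one h.2] at h1
  rw [mul_right_cancel₀ hvu h1]
  push_cast
  ring_nf

theorem isMinPSTTime_blowUp_two {G : SimpleGraph V} {u : V} {lam : ℝ} (hl : 0 < lam)
    [DecidableEq V]
    (hcube : adjOp G (adjOp G (adjOp G (Pi.single u 1))) =
      (lam ^ 2 : ℂ) • adjOp G (Pi.single u 1))
    (hsq : adjOp G (adjOp G (Pi.single u 1)) u = (lam ^ 2 : ℂ))
    {v : V → ℂ} (hv : adjOp G v = (lam : ℂ) • v) (hvu : v u ≠ 0) :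
    IsMinPSTTime (blowUp 2 G) (0, u) (1, u) (Real.pi / (2 * lam)) := by
  have hπ := Real.pi_pos
  have hl' : (lam : ℂ) ≠ 0 := Complex.ofReal_ne_zero.2 hl.ne'
  refine ⟨⟨by positivity, ?_⟩, ?_⟩
  · have hc : Complex.exp
        (Complex.I * ((Real.pi / (2 * lam) * ((2 : ℕ) * lam) : ℝ) : ℂ)) = -1 := by
      have : Real.pi / (2 * lam) * ((2 : ℕ) * lam) = Real.pi := by push_cast; field_simp
      rw [this, mul_comm, Complex.exp_pi_mul_I]
    rw [transitionMatrix_blowUp_apply hl (by convert hcube) hc (by simp)]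
    convert_to ‖(0 : ℂ) + (-1 - 1) / ((2 : ℕ) * (lam : ℂ) ^ 2) * (lam : ℂ) ^ 2‖ = 1
    · rw [if_neg (by decide), ← hsq]
      congr!
    · have : (0 : ℂ) + (-1 - 1) / ((2 : ℕ) * (lam : ℂ) ^ 2) * (lam : ℂ) ^ 2 = -1 := by
        push_cast; field_simp; ring
      rw [this]
      simp
  · intro s hs
    have hs0 := hs.1
    have h1 := exp_eq_neg_one_of_hasPSTAt hs hv hvu
    -- Squaring the phase -1 gives 1.
    have h2 := two_pi_le_of_exp_eq_one (a := 2 * (s * 2 * lam)) (by positivity) (by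
      rw [Complex.ofReal_mul, mul_left_comm, Complex.ofReal_ofNat, two_mul, Complex.exp_add, h1]
      norm_num)
    rw [div_le_iff₀ (by positivity)]
    linarith

end BlowUp
-- Rational ratios of cosines and Niven's theorem
theorem exists_rat_eq_sq_of_ratios {x : ℝ} {q r : ℚ} (h2 : x ^ 2 - 2 = q * x)
    (h5 : x ^ 4 - 5 * x ^ 2 + 5 = r) : ∃ p : ℚ, x ^ 2 = p := by
  have hsq : (x ^ 2 - 2) ^ 2 = q ^ 2 * x ^ 2 := by rw [h2]; ring
  -- Eliminating x⁴ between `hsq` and `h5` leaves (1 - q²)x² = 1 - r, which is degenerate exactly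
  -- when q² = 1.
  by_cases hq : (q : ℝ) ^ 2 = 1
  · have h : (x ^ 2 - 1) * (x ^ 2 - 4) = 0 := by
      rw [hq] at hsq
      linear_combination hsq
    rcases mul_eq_zero.1 h with h | h
    · exact ⟨1, by push_cast; linarith⟩
    · exact ⟨4, by push_cast; linarith⟩
  · refine ⟨(1 - r) / (1 - q ^ 2), ?_⟩
    push_cast
    rw [eq_div_iff (sub_ne_zero.2 (Ne.symm hq))]
    linear_combination hsq - h5

theorem eq_of_rat_cos_two_pi_div {N : ℕ} (hN : 3 ≤ N) {p : ℚ}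
    (hp : Real.cos (2 * (Real.pi / N)) = p) : N = 3 ∨ N = 4 ∨ N = 6 := by
  have hN' : (3 : ℚ) ≤ N := by exact_mod_cast hN
  have hN0 : (N : ℚ) ≠ 0 := by positivity
  have h := niven_angle_div_pi_eq (r := 2 / N)
    ⟨p, by rw [← hp]; congr 1; push_cast; ring⟩
    ⟨by positivity, by rw [div_le_one (by positivity)]; linarith⟩
  simp only [Set.mem_insert_iff, Set.mem_singleton_iff] at h
  rcases h with h | h | h | h | h <;> field_simp at h
  · norm_num at h
  · right; right; exact_mod_cast (by linarith : (N : ℚ) = 6)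
  · right; left; exact_mod_cast (by linarith : (N : ℚ) = 4)
  · left; exact_mod_cast (by linarith : (N : ℚ) = 3)
  · linarith

/-- Selects indices in the support of a vertex: either 3, or both 2 and 5, next to 1. If sin 3φ = 0,
then sin 5φ = cos 3φ · sin 2φ with cos 3φ = ±1. -/
theorem sin_two_or_three_five_ne_zero {φ : ℝ} (h : Real.sin φ ≠ 0) :
    Real.sin (3 * φ) ≠ 0 ∨ (Real.sin (2 * φ) ≠ 0 ∧ Real.sin (5 * φ) ≠ 0) := by
  by_cases h3 : Real.sin (3 * φ) = 0
  · right
    have hs : Real.sin φ ^ 2 = 3 / 4 := by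
      rw [Real.sin_three_mul] at h3
      have : Real.sin φ * (3 - 4 * Real.sin φ ^ 2) = 0 := by linear_combination h3
      rcases mul_eq_zero.1 this with h' | h'
      · exact absurd h' h
      · linarith
    have hc : Real.cos φ ≠ 0 := by
      intro hc
      have := Real.sin_sq_add_cos_sq φ
      rw [hc, hs] at this
      norm_num at this
    have h2 : Real.sin (2 * φ) ≠ 0 := by
      rw [Real.sin_two_mul]
      exact mul_ne_zero (mul_ne_zero two_ne_zero h) hc
    refine ⟨h2, ?_⟩
    have : 5 * φ = 3 * φ + 2 * φ := by ring
    rw [this, Real.sin_add, h3, zero_mul, zero_add]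
    refine mul_ne_zero (fun hc3 => ?_) h2
    have := Real.sin_sq_add_cos_sq (3 * φ)
    rw [hc3, h3] at this
    norm_num at this
  · exact Or.inl h3

theorem two_cos_five_mul (θ : ℝ) : 2 * Real.cos (5 * θ) =
    (2 * Real.cos θ) ^ 5 - 5 * (2 * Real.cos θ) ^ 3 + 5 * (2 * Real.cos θ) := by
  have : 5 * θ = 3 * θ + 2 * θ := by ring
  rw [this, Real.cos_add, Real.cos_three_mul, Real.cos_two_mul, Real.sin_three_mul,
    Real.sin_two_mul]
  have h := Real.sin_sq_add_cos_sq θ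
  have h1 : Real.sin θ ^ 2 = 1 - Real.cos θ ^ 2 := by linarith
  have h2 : Real.sin θ ^ 4 = (1 - Real.cos θ ^ 2) ^ 2 := by rw [← h1]; ring
  ring_nf
  rw [h1, h2]
  ring

/-- If the eigenvalues `2 cos (k π / N)` in the support of the vertex `a` of the path with `N - 1`
vertices `1, …, N - 1` are pairwise commensurable, then the path is `P₂`, `P₃`, or `P₅` with `a`
its middle vertex. -/
theorem eq_of_commensurable {N a : ℕ} (hN : 3 ≤ N) (ha : 0 < a) (haN : a < N) {s : ℝ} (hs : 0 < s)
    (H : ∀ k : ℕ, Real.sin (k * (a * (Real.pi / N))) ≠ 0 →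
      ∃ z : ℤ, s * (2 * Real.cos (k * (Real.pi / N))) = z * Real.pi) :
    N = 3 ∨ N = 4 ∨ (N = 6 ∧ a = 3) := by
  have hπ := Real.pi_pos
  have hN0 : (0 : ℝ) < N := by positivity
  have hN3 : (3 : ℝ) ≤ N := by exact_mod_cast hN
  set θ := Real.pi / N with hθ
  have hθN : θ * N = Real.pi := by rw [hθ]; field_simp
  have hθ0 : 0 < θ := by positivity
  have ha0 : (0 : ℝ) < a := by positivity
  have haN' : (a : ℝ) < N := by exact_mod_cast haN
  have hφ : Real.sin (a * θ) ≠ 0 :=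
    (Real.sin_pos_of_pos_of_lt_pi (by positivity) (by nlinarith)).ne'
  set x := 2 * Real.cos θ with hx
  have hx0 : 0 < x := by
    have := Real.cos_pos_of_mem_Ioo (x := θ) ⟨by linarith, by nlinarith⟩
    positivity
  obtain ⟨z₁, hz₁⟩ := H 1 (by simpa using hφ)
  rw [Nat.cast_one, one_mul] at hz₁
  have hz₁0 : (z₁ : ℝ) ≠ 0 := by
    intro h
    rw [h, zero_mul] at hz₁
    exact (mul_pos hs hx0).ne' hz₁
  have ratio : ∀ k : ℕ, Real.sin (k * (a * θ)) ≠ 0 →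
      ∃ q : ℚ, 2 * Real.cos (k * θ) = q * x := by
    intro k hk
    obtain ⟨z, hz⟩ := H k hk
    refine ⟨z / z₁, ?_⟩
    push_cast
    rw [div_mul_eq_mul_div, eq_div_iff hz₁0]
    apply mul_left_cancel₀ (mul_pos hs hπ).ne'
    linear_combination z₁ * Real.pi * hz - z * Real.pi * hz₁
  have two_cos : 2 * Real.cos (2 * θ) = x ^ 2 - 2 := by
    rw [Real.cos_two_mul, hx]; ring
  -- Index 3 gives x² - 3 rational directly. Indices 2 and 5 give the two relations of
  -- `exists_rat_eq_sq_of_ratios`.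
  have hx2 : ∃ p : ℚ, x ^ 2 = p := by
    rcases sin_two_or_three_five_ne_zero hφ with h3 | ⟨h2, h5⟩
    · obtain ⟨q, hq⟩ := ratio 3 (by exact_mod_cast h3)
      refine ⟨q + 3, ?_⟩
      apply mul_right_cancel₀ hx0.ne'
      push_cast at hq ⊢
      rw [Real.cos_three_mul] at hq
      have : x ^ 3 - 3 * x = q * x := by rw [← hq, hx]; ring
      linear_combination this
    · obtain ⟨q, hq⟩ := ratio 2 (by exact_mod_cast h2)
      obtain ⟨r, hr⟩ := ratio 5 (by exact_mod_cast h5)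
      push_cast at hq hr
      rw [two_cos] at hq
      refine exists_rat_eq_sq_of_ratios hq (r := r) ?_
      apply mul_right_cancel₀ hx0.ne'
      rw [two_cos_five_mul] at hr
      linear_combination hr
  obtain ⟨p, hp⟩ := hx2
  -- Here cos 2θ = (x² - 2)/2.
  rcases eq_of_rat_cos_two_pi_div hN (p := (p - 2) / 2) (by
    push_cast; rw [← hp]; linarith) with h | h | h
  · exact Or.inl h
  · exact Or.inr (Or.inl h)
  · refine Or.inr (Or.inr ⟨h, ?_⟩)
    by_contra ha3
    have h6 : (N : ℝ) = 6 := by exact_mod_cast h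
    have hθ6 : θ = Real.pi / 6 := by rw [hθ, h6]
    -- For N = 6, index 2 is outside the support only if 3 divides a. Otherwise 2cos(π/3) = 1 would
    -- be a rational multiple of √3.
    have hne : Real.sin (((2 : ℕ) : ℝ) * (a * θ)) ≠ 0 := by
      intro h0
      obtain ⟨z, hz⟩ := Real.sin_eq_zero_iff.1 h0
      rw [hθ6] at hz
      have : (3 * z : ℝ) = a := by
        apply mul_right_cancel₀ hπ.ne'
        push_cast at hz
        linear_combination 3 * hz
      have : 3 * z = a := by exact_mod_cast this
      omega
    obtain ⟨q, hq⟩ := ratio 2 hne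
    push_cast at hq
    have hx3 : x = √3 := by rw [hx, hθ6, Real.cos_pi_div_six]; ring
    rw [two_cos, hx3, Real.sq_sqrt (by norm_num)] at hq
    have hirr : Irrational (√3) := by
      simpa using Nat.Prime.irrational_sqrt (p := 3) (by norm_num)
    apply hirr
    refine ⟨3 * q, ?_⟩
    have h3 : √3 * √3 = 3 := Real.mul_self_sqrt (by norm_num)
    push_cast
    linear_combination (-√3) * hq - (q : ℝ) * h3

/-! ### Eigenvectors of the path -/

/-- The Dirichlet eigenfunctions of the path. -/
noncomputable def pathEigenvector (n k : ℕ) (i : Fin n) : ℂ :=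
  (Real.sin (k * ((i.val + 1 : ℕ) * (Real.pi / (n + 1 : ℕ)))) : ℝ)

/-- Vertex `i` sits at position i + 1; zero values at positions 0 and n + 1 make the two-neighbour
formula valid at the ends too. -/
theorem adjOp_pathGraph (n : ℕ) (f : ℕ → ℂ) (h0 : f 0 = 0) (hn : f (n + 1) = 0) (i : Fin n) :
    adjOp (SimpleGraph.pathGraph n) (fun j => f (j.val + 1)) i = f i.val + f (i.val + 2) := by
  classical
  rw [adjOp_apply]
  have hsplit : ∀ j : Fin n, (if (SimpleGraph.pathGraph n).Adj i j then f (j.val + 1) else 0) =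
      (if j.val + 1 = i.val then f i.val else 0) +
        (if j.val = i.val + 1 then f (i.val + 2) else 0) := by
    intro j
    rw [SimpleGraph.pathGraph_adj]
    by_cases h1 : j.val + 1 = i.val
    · rw [if_pos (Or.inr h1), if_pos h1, if_neg (by omega), h1, add_zero]
    · by_cases h2 : j.val = i.val + 1
      · rw [if_pos (Or.inl h2.symm), if_neg h1, if_pos h2, h2, zero_add]
      · rw [if_neg (by omega), if_neg h1, if_neg h2, add_zero]
  rw [Finset.sum_congr rfl fun j _ => hsplit j, Finset.sum_add_distrib]
  have hi := i.isLt
  congr 1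
  · rcases Nat.eq_zero_or_pos i.val with h | h
    · simp [h, h0]
    · rw [Finset.sum_eq_single ⟨i.val - 1, by omega⟩]
      · rw [if_pos (by simp; omega)]
      · intro b _ hb
        rw [if_neg]
        intro h'
        exact hb (Fin.ext (by simp; omega))
      · simp
  · rcases Nat.lt_or_ge (i.val + 1) n with h | h
    · rw [Finset.sum_eq_single ⟨i.val + 1, h⟩]
      · rw [if_pos rfl]
      · intro b _ hb
        rw [if_neg]
        exact fun h' => hb (Fin.ext h')
      · simp
    · have : i.val + 2 = n + 1 := by omega
      rw [this, hn]
      simp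

theorem adjOp_pathEigenvector (n k : ℕ) :
    adjOp (SimpleGraph.pathGraph n) (pathEigenvector n k) =
      ((2 * Real.cos (k * (Real.pi / (n + 1 : ℕ))) : ℝ) : ℂ) • pathEigenvector n k := by
  ext i
  have h := adjOp_pathGraph n
    (fun j => ((Real.sin (k * (j * (Real.pi / (n + 1 : ℕ)))) : ℝ) : ℂ)) (by simp)
    (by
      have : (k : ℝ) * ((n + 1 : ℕ) * (Real.pi / (n + 1 : ℕ))) = k * Real.pi := by
        field_simp
      simp only [this, Real.sin_nat_mul_pi, Complex.ofReal_zero]) i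
  change adjOp _ (fun j : Fin n => _) i = _
  refine h.trans ?_
  simp only [Pi.smul_apply, smul_eq_mul, pathEigenvector]
  rw [← Complex.ofReal_add, ← Complex.ofReal_mul]
  congr 1
  set θ := Real.pi / (n + 1 : ℕ)
  have e1 : (k : ℝ) * (i.val * θ) = k * ((i.val + 1 : ℕ) * θ) - k * θ := by push_cast; ring
  have e2 : (k : ℝ) * ((i.val + 2 : ℕ) * θ) = k * ((i.val + 1 : ℕ) * θ) + k * θ := by
    push_cast; ring
  rw [e1, e2, Real.sin_sub, Real.sin_add]
  ring

/-- The bipartite partner: shifting the index by n + 1 alternates signs and negates the eigenvalue,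
without changing where the vector vanishes. -/
theorem pathEigenvector_add (n k : ℕ) (i : Fin n) :
    pathEigenvector n (k + (n + 1)) i = (-1) ^ (i.val + 1) * pathEigenvector n k i := by
  unfold pathEigenvector
  have : ((k + (n + 1) : ℕ) : ℝ) * ((i.val + 1 : ℕ) * (Real.pi / (n + 1 : ℕ))) =
      k * ((i.val + 1 : ℕ) * (Real.pi / (n + 1 : ℕ))) + (i.val + 1 : ℕ) * Real.pi := by
    push_cast
    field_simp
  rw [this, Real.sin_add_nat_mul_pi]
  push_cast
  ring

theorem cos_add_pathEigenvalue (n k : ℕ) :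
    Real.cos ((k + (n + 1) : ℕ) * (Real.pi / (n + 1 : ℕ))) =
      -Real.cos (k * (Real.pi / (n + 1 : ℕ))) := by
  have : ((k + (n + 1) : ℕ) : ℝ) * (Real.pi / (n + 1 : ℕ)) =
      k * (Real.pi / (n + 1 : ℕ)) + Real.pi := by
    push_cast
    field_simp
  rw [this, Real.cos_add_pi]

/-! ### Commensurability from periodicity or state transfer -/

theorem commensurable_of_isPeriodicAt {n m : ℕ} [NeZero m] {u : Fin n} {j : ZMod m} {t : ℝ}
    (h : IsPeriodicAt (blowUp m (SimpleGraph.pathGraph n)) (j, u) t) (k : ℕ)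
    (hk : Real.sin (k * ((u.val + 1 : ℕ) * (Real.pi / (n + 1 : ℕ)))) ≠ 0) :
    ∃ z : ℤ, t * m * (2 * Real.cos (k * (Real.pi / (n + 1 : ℕ)))) = z * Real.pi := by
  have hv : pathEigenvector n k u ≠ 0 := Complex.ofReal_ne_zero.2 hk
  have hv' : pathEigenvector n (k + (n + 1)) u ≠ 0 := by
    rw [pathEigenvector_add]
    exact mul_ne_zero (pow_ne_zero _ (by norm_num)) hv
  have h1 := transitionMatrix_mul_eigenvector h.2
    (adjOp_blowUp_const (m := m) (adjOp_pathEigenvector n k))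
  have h2 := transitionMatrix_mul_eigenvector h.2
    (adjOp_blowUp_const (m := m) (adjOp_pathEigenvector n (k + (n + 1))))
  have h3 := (mul_right_cancel₀ hv h1).symm.trans (mul_right_cancel₀ hv' h2)
  rw [cos_add_pathEigenvalue] at h3
  set lam := 2 * Real.cos (k * (Real.pi / (n + 1 : ℕ))) with hlam
  -- The quotient of the phases at mλ and -mλ is 1.
  obtain ⟨z, hz⟩ := Complex.exists_int_of_exp_eq_one (a := 2 * (t * m * lam)) (by
    have : Complex.I * ((2 * (t * m * lam) : ℝ) : ℂ) = Complex.I * t * (m * (lam : ℂ)) -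
        Complex.I * t * (m * ((2 * -Real.cos (k * (Real.pi / (n + 1 : ℕ))) : ℝ) : ℂ)) := by
      rw [hlam]; push_cast; ring
    rw [this, Complex.exp_sub, h3, div_self (Complex.exp_ne_zero _)])
  exact ⟨z, by linarith⟩

theorem commensurable_of_hasPSTAt {n : ℕ} {u : Fin n} {t : ℝ}
    (h : HasPSTAt (blowUp 2 (SimpleGraph.pathGraph n)) (0, u) (1, u) t) (k : ℕ)
    (hk : Real.sin (k * ((u.val + 1 : ℕ) * (Real.pi / (n + 1 : ℕ)))) ≠ 0) :
    ∃ z : ℤ, t * 2 * (2 * Real.cos (k * (Real.pi / (n + 1 : ℕ)))) = z * Real.pi := by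
  have h1 := exp_eq_neg_one_of_hasPSTAt h (adjOp_pathEigenvector n k)
    (Complex.ofReal_ne_zero.2 hk)
  set lam := 2 * Real.cos (k * (Real.pi / (n + 1 : ℕ))) with hlam
  obtain ⟨z, hz⟩ := Complex.exists_int_of_exp_eq_one (a := 2 * (t * 2 * lam)) (by
    rw [Complex.ofReal_mul, mul_left_comm, Complex.ofReal_ofNat, two_mul, Complex.exp_add, h1]
    norm_num)
  exact ⟨z, by linarith⟩

/-- Transfer requires phase -1 on the support of u, while eigenvalue 0 has phase 1. -/
theorem not_hasPSTAt_of_adjOp_eq_zero {V : Type*} [Fintype V] {G : SimpleGraph V} {u : V}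
    {v : V → ℂ} (hv : adjOp G v = (0 : ℂ) • v) (hvu : v u ≠ 0) (t : ℝ) :
    ¬ HasPSTAt (blowUp 2 G) (0, u) (1, u) t := by
  intro h
  have := exp_eq_neg_one_of_hasPSTAt (lam := 0) h (by simpa using hv) hvu
  norm_num at this

/-! ### Explicit data for the small paths -/

theorem adjOp_pathGraph_one (v : Fin 1 → ℂ) :
    adjOp (SimpleGraph.pathGraph 1) v = ![0] := by
  classical
  ext i
  rw [adjOp_apply]
  fin_cases i
  simp

theorem adjOp_pathGraph_two (v : Fin 2 → ℂ) :
    adjOp (SimpleGraph.pathGraph 2) v = ![v 1, v 0] := by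
  classical
  ext i
  rw [adjOp_apply]
  fin_cases i <;> simp [SimpleGraph.pathGraph_adj, Fin.sum_univ_succ]

theorem adjOp_pathGraph_three (v : Fin 3 → ℂ) :
    adjOp (SimpleGraph.pathGraph 3) v = ![v 1, v 0 + v 2, v 1] := by
  classical
  ext i
  rw [adjOp_apply]
  fin_cases i <;> simp [SimpleGraph.pathGraph_adj, Fin.sum_univ_succ]

theorem adjOp_pathGraph_five (v : Fin 5 → ℂ) :
    adjOp (SimpleGraph.pathGraph 5) v = ![v 1, v 0 + v 2, v 1 + v 3, v 2 + v 4, v 3] := by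
  classical
  ext i
  rw [adjOp_apply]
  simp only [SimpleGraph.pathGraph_adj, Fin.sum_univ_five]
  fin_cases i <;> simp

theorem pathGraph_two_cube (u : Fin 2) :
    adjOp (SimpleGraph.pathGraph 2) (adjOp (SimpleGraph.pathGraph 2)
      (adjOp (SimpleGraph.pathGraph 2) (Pi.single u 1))) =
      ((1 : ℝ) ^ 2 : ℂ) • adjOp (SimpleGraph.pathGraph 2) (Pi.single u 1) := by
  simp [adjOp_pathGraph_two]

theorem pathGraph_two_sq (u : Fin 2) :
    adjOp (SimpleGraph.pathGraph 2) (adjOp (SimpleGraph.pathGraph 2) (Pi.single u 1)) u =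
      ((1 : ℝ) ^ 2 : ℂ) := by
  fin_cases u <;> simp [adjOp_pathGraph_two]

theorem pathGraph_two_eigenvector :
    adjOp (SimpleGraph.pathGraph 2) ![1, 1] = ((1 : ℝ) : ℂ) • ![1, 1] := by
  simp [adjOp_pathGraph_two]

theorem pathGraph_two_eigenvector_neg :
    adjOp (SimpleGraph.pathGraph 2) ![1, -1] = (-((1 : ℝ) : ℂ)) • ![1, -1] := by
  simp [adjOp_pathGraph_two]

theorem ofReal_sqrt_sq {a : ℝ} (ha : 0 ≤ a) : ((√a : ℝ) : ℂ) ^ 2 = a := by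
  rw [← Complex.ofReal_pow, Real.sq_sqrt ha]

theorem pathGraph_three_cube (u : Fin 3) :
    adjOp (SimpleGraph.pathGraph 3) (adjOp (SimpleGraph.pathGraph 3)
      (adjOp (SimpleGraph.pathGraph 3) (Pi.single u 1))) =
      ((√2 : ℝ) ^ 2 : ℂ) • adjOp (SimpleGraph.pathGraph 3) (Pi.single u 1) := by
  rw [ofReal_sqrt_sq (by norm_num)]
  simp only [adjOp_pathGraph_three]
  ext i
  fin_cases i <;> simp <;> ring

theorem pathGraph_three_sq :
    adjOp (SimpleGraph.pathGraph 3) (adjOp (SimpleGraph.pathGraph 3) (Pi.single 1 1)) 1 =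
      ((√2 : ℝ) ^ 2 : ℂ) := by
  rw [ofReal_sqrt_sq (by norm_num)]
  simp [adjOp_pathGraph_three]
  norm_num

theorem pathGraph_three_eigenvector {c : ℂ} (hc : c ^ 2 = 2) :
    adjOp (SimpleGraph.pathGraph 3) ![1, c, 1] = c • ![1, c, 1] := by
  have : c * c = 2 := by rw [← sq, hc]
  ext i
  fin_cases i <;> simp [adjOp_pathGraph_three, this]
  norm_num

theorem pathGraph_three_kernel :
    adjOp (SimpleGraph.pathGraph 3) ![1, 0, -1] = (0 : ℂ) • ![1, 0, -1] := by
  ext i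
  fin_cases i <;> simp [adjOp_pathGraph_three]

theorem pathGraph_five_cube :
    adjOp (SimpleGraph.pathGraph 5) (adjOp (SimpleGraph.pathGraph 5)
      (adjOp (SimpleGraph.pathGraph 5) (Pi.single 2 1))) =
      ((√3 : ℝ) ^ 2 : ℂ) • adjOp (SimpleGraph.pathGraph 5) (Pi.single 2 1) := by
  rw [ofReal_sqrt_sq (by norm_num)]
  simp only [adjOp_pathGraph_five]
  ext i
  fin_cases i <;> simp <;> norm_num

theorem pathGraph_five_eigenvector :
    adjOp (SimpleGraph.pathGraph 5) ![1, (√3 : ℝ), 2, (√3 : ℝ), 1] =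
      ((√3 : ℝ) : ℂ) • ![1, ((√3 : ℝ) : ℂ), 2, (√3 : ℝ), 1] := by
  have h : ((√3 : ℝ) : ℂ) * (√3 : ℝ) = 3 := by
    rw [← sq, ofReal_sqrt_sq (by norm_num)]; norm_num
  ext i
  fin_cases i <;> simp [adjOp_pathGraph_five, h] <;> ring

theorem pathGraph_five_kernel :
    adjOp (SimpleGraph.pathGraph 5) ![1, 0, -1, 0, 1] = (0 : ℂ) • ![1, 0, -1, 0, 1] := by
  ext i
  fin_cases i <;> simp [adjOp_pathGraph_five]

/-! ### Minimum times for the small paths -/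

theorem isMinPeriod_blowUp_pathGraph_two {m : ℕ} [NeZero m] (u : Fin 2) (hm : m ≠ 1)
    (j : ZMod m) :
    IsMinPeriod (blowUp m (SimpleGraph.pathGraph 2)) (j, u) (2 * Real.pi / m) := by
  have := isMinPeriod_blowUp one_pos (pathGraph_two_cube u) pathGraph_two_eigenvector
    (by fin_cases u <;> simp) (Or.inl hm) j
  simpa using this

theorem isMinPeriod_pathGraph_two (u : Fin 2) (j : ZMod 1) :
    IsMinPeriod (blowUp 1 (SimpleGraph.pathGraph 2)) (j, u) Real.pi := by
  have := isMinPeriod_blowUp_one one_pos (pathGraph_two_cube u) (pathGraph_two_sq u)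
    pathGraph_two_eigenvector (by fin_cases u <;> simp) pathGraph_two_eigenvector_neg
    (by fin_cases u <;> simp) j
  simpa using this

theorem isMinPeriod_blowUp_pathGraph_three {m : ℕ} [NeZero m] (u : Fin 3)
    (h : m ≠ 1 ∨ u.val ≠ 1) (j : ZMod m) :
    IsMinPeriod (blowUp m (SimpleGraph.pathGraph 3)) (j, u) (2 * Real.pi / (√2 * m)) := by
  refine isMinPeriod_blowUp (by positivity) (pathGraph_three_cube u)
    (pathGraph_three_eigenvector (by rw [ofReal_sqrt_sq (by norm_num)]; norm_num))
    (by fin_cases u <;> simp) (h.imp_right fun hu => ⟨_, pathGraph_three_kernel, ?_⟩) j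
  fin_cases u <;> simp at hu ⊢

theorem isMinPeriod_pathGraph_three (j : ZMod 1) :
    IsMinPeriod (blowUp 1 (SimpleGraph.pathGraph 3)) (j, 1) (Real.pi / √2) :=
  isMinPeriod_blowUp_one (by positivity) (pathGraph_three_cube 1) pathGraph_three_sq
    (pathGraph_three_eigenvector (by rw [ofReal_sqrt_sq (by norm_num)]; norm_num)) (by simp)
    (pathGraph_three_eigenvector (by rw [neg_sq, ofReal_sqrt_sq (by norm_num)]; norm_num))
    (by simp) j

theorem isMinPeriod_blowUp_pathGraph_five {m : ℕ} [NeZero m] (j : ZMod m) :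
    IsMinPeriod (blowUp m (SimpleGraph.pathGraph 5)) (j, 2) (2 * Real.pi / (√3 * m)) :=
  isMinPeriod_blowUp (by positivity) pathGraph_five_cube pathGraph_five_eigenvector (by simp)
    (Or.inr ⟨_, pathGraph_five_kernel, by simp⟩) j

theorem isMinPSTTime_pathGraph_two (u : Fin 2) :
    IsMinPSTTime (blowUp 2 (SimpleGraph.pathGraph 2)) (0, u) (1, u) (Real.pi / 2) := by
  have := isMinPSTTime_blowUp_two one_pos (pathGraph_two_cube u) (pathGraph_two_sq u)
    pathGraph_two_eigenvector (by fin_cases u <;> simp)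
  simpa using this

theorem isMinPSTTime_pathGraph_three :
    IsMinPSTTime (blowUp 2 (SimpleGraph.pathGraph 3)) (0, 1) (1, 1) (Real.pi / (2 * √2)) :=
  isMinPSTTime_blowUp_two (by positivity) (pathGraph_three_cube 1) pathGraph_three_sq
    (pathGraph_three_eigenvector (by rw [ofReal_sqrt_sq (by norm_num)]; norm_num)) (by simp)

theorem isPeriodicAt_blowUp_pathGraph_two {m : ℕ} [NeZero m] (u : Fin 2) (j : ZMod m) :
    IsPeriodicAt (blowUp m (SimpleGraph.pathGraph 2)) (j, u) (2 * Real.pi / m) := by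
  have := isPeriodicAt_blowUp (m := m) one_pos (pathGraph_two_cube u) j
  simpa using this

theorem isPeriodicAt_blowUp_pathGraph_three {m : ℕ} [NeZero m] (u : Fin 3) (j : ZMod m) :
    IsPeriodicAt (blowUp m (SimpleGraph.pathGraph 3)) (j, u) (2 * Real.pi / (√2 * m)) :=
  isPeriodicAt_blowUp (by positivity) (pathGraph_three_cube u) j

/-! ### Classification -/

theorem isPeriodicVertex_blowUp_pathGraph_iff {n : ℕ} (hn : 2 ≤ n) (u : Fin n) (m : ℕ)
    [NeZero m] :
    (∀ j : ZMod m, IsPeriodicVertex (blowUp m (SimpleGraph.pathGraph n)) (j, u)) ↔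
      n = 2 ∨ n = 3 ∨ (n = 5 ∧ u.val = 2) := by
  constructor
  · intro h
    -- A single periodic copy already forces the conclusion.
    obtain ⟨t, ht⟩ := h 0
    have hm : (0 : ℝ) < m := Nat.cast_pos.2 (NeZero.pos m)
    have := eq_of_commensurable (N := n + 1) (a := u.val + 1) (by omega) (by omega)
      (by omega) (mul_pos ht.1 hm) (commensurable_of_isPeriodicAt ht)
    omega
  · rintro (rfl | rfl | ⟨rfl, hu⟩) j
    · exact ⟨_, isPeriodicAt_blowUp_pathGraph_two u j⟩
    · exact ⟨_, isPeriodicAt_blowUp_pathGraph_three u j⟩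
    · obtain rfl : u = 2 := Fin.ext hu
      exact ⟨_, (isMinPeriod_blowUp_pathGraph_five j).1⟩

theorem hasPST_blowUp_two_pathGraph_iff {n : ℕ} (u : Fin n) :
    HasPST (blowUp 2 (SimpleGraph.pathGraph n)) (0, u) (1, u) ↔
      n = 2 ∨ (n = 3 ∧ u.val = 1) := by
  constructor
  · rintro ⟨t, ht⟩
    -- The one-vertex path has no edges, so 0 is in the support. The end vertices of P₃ and the
    -- middle of P₅ are excluded below for the same reason.
    rcases Nat.lt_or_ge n 2 with hn | hn
    · obtain rfl : n = 1 := by have := u.isLt; omega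
      refine absurd ht (not_hasPSTAt_of_adjOp_eq_zero (v := fun _ => 1) ?_ one_ne_zero t)
      ext i
      fin_cases i
      simp [adjOp_pathGraph_one]
    · have ht0 := ht.1
      have := eq_of_commensurable (N := n + 1) (a := u.val + 1) (by omega) (by omega)
        (by omega) (by positivity) (commensurable_of_hasPSTAt ht)
      have h5 : n = 2 ∨ n = 3 ∨ (n = 5 ∧ u.val = 2) := by omega
      rcases h5 with rfl | rfl | ⟨rfl, hu⟩
      · exact Or.inl rfl
      · refine Or.inr ⟨rfl, ?_⟩
        by_contra hu
        refine not_hasPSTAt_of_adjOp_eq_zero pathGraph_three_kernel ?_ t ht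
        fin_cases u <;> simp at hu ⊢
      · obtain rfl : u = 2 := Fin.ext hu
        exact absurd ht (not_hasPSTAt_of_adjOp_eq_zero pathGraph_five_kernel (by simp) t)
  · rintro (rfl | ⟨rfl, hu⟩)
    · exact ⟨_, (isMinPSTTime_pathGraph_two u).1⟩
    · obtain rfl : u = 1 := Fin.ext hu
      exact ⟨_, isMinPSTTime_pathGraph_three.1⟩

/-- The vertices of the path on `n` vertices are `0, …, n - 1`, so the middle vertex of the path on
three (five) vertices is `1` (`2`). -/
theorem mainTheorem9 (n : ℕ) (u : Fin n) :
    -- which vertices have periodic copies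
    (2 ≤ n → ∀ (m : ℕ) [NeZero m],
      ((∀ j : ZMod m, IsPeriodicVertex (blowUp m (SimpleGraph.pathGraph n)) (j, u)) ↔
        n = 2 ∨ n = 3 ∨ (n = 5 ∧ u.val = 2))) ∧
    -- the periods
    (∀ (m : ℕ) [NeZero m] (j : ZMod m),
      (n = 2 →
        IsPeriodicAt (blowUp m (SimpleGraph.pathGraph n)) (j, u) (2 * Real.pi / m) ∧
        (m ≠ 1 →
          IsMinPeriod (blowUp m (SimpleGraph.pathGraph n)) (j, u) (2 * Real.pi / m)) ∧
        (m = 1 →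
          IsMinPeriod (blowUp m (SimpleGraph.pathGraph n)) (j, u) Real.pi)) ∧
      (n = 3 →
        IsPeriodicAt (blowUp m (SimpleGraph.pathGraph n)) (j, u)
          (2 * Real.pi / (Real.sqrt 2 * m)) ∧
        (m ≠ 1 ∨ u.val ≠ 1 →
          IsMinPeriod (blowUp m (SimpleGraph.pathGraph n)) (j, u)
            (2 * Real.pi / (Real.sqrt 2 * m))) ∧
        (m = 1 → u.val = 1 →
          IsMinPeriod (blowUp m (SimpleGraph.pathGraph n)) (j, u)
            (Real.pi / Real.sqrt 2))) ∧
      (n = 5 → u.val = 2 →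
        IsMinPeriod (blowUp m (SimpleGraph.pathGraph n)) (j, u)
          (2 * Real.pi / (Real.sqrt 3 * m)))) ∧
    -- perfect state transfer between the two copies in the 2-fold blow-up
    (HasPST (blowUp 2 (SimpleGraph.pathGraph n)) (0, u) (1, u) ↔
      n = 2 ∨ (n = 3 ∧ u.val = 1)) ∧
    (n = 2 →
      IsMinPSTTime (blowUp 2 (SimpleGraph.pathGraph n)) (0, u) (1, u) (Real.pi / 2)) ∧
    (n = 3 → u.val = 1 →
      IsMinPSTTime (blowUp 2 (SimpleGraph.pathGraph n)) (0, u) (1, u)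
        (Real.pi / (2 * Real.sqrt 2))) := by
  refine ⟨fun hn m _ => isPeriodicVertex_blowUp_pathGraph_iff hn u m, fun m _ j => ⟨?_, ?_, ?_⟩,
    hasPST_blowUp_two_pathGraph_iff u, ?_, ?_⟩
  · rintro rfl
    refine ⟨isPeriodicAt_blowUp_pathGraph_two u j,
      fun hm => isMinPeriod_blowUp_pathGraph_two u hm j, ?_⟩
    rintro rfl
    convert isMinPeriod_pathGraph_two u j
  · rintro rfl
    refine ⟨isPeriodicAt_blowUp_pathGraph_three u j,
      fun h => isMinPeriod_blowUp_pathGraph_three u h j, ?_⟩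
    rintro rfl hu
    obtain rfl : u = 1 := Fin.ext hu
    convert isMinPeriod_pathGraph_three j
  · rintro rfl hu
    obtain rfl : u = 2 := Fin.ext hu
    exact isMinPeriod_blowUp_pathGraph_five j
  · rintro rfl
    exact isMinPSTTime_pathGraph_two u
  · rintro rfl hu
    obtain rfl : u = 1 := Fin.ext hu
    exact isMinPSTTime_pathGraph_three
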